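/- Words are elements of $\mathbb F_2^{n}$, and $d_H$ is the Hamming distance. A $(20,8)$-code is a subset of $\mathbb F_2^{20}$ in which any two distinct words have distance at least $8$. Two codes $C,C'\subseteq\mathbb F_2^n$ are equivalent if $C'$ can be obtained from $C$ by first permuting the $n$ coordinates and then permuting the alphabet $\{0,1\}$ in each coordinate separately. Let $B\subseteq\mathbb F_2^{20}$ be the quadruply shortened extended binary Golay code, that is, the linear code formed by the words of the extended binary Golay code that start with $0000$, with these first four positions removed; here the extended binary Golay code is the cyclic code of length $23$ generated by $1+X^2+X^4+X^5+X^6+X^{10}+X^{11}$, extended by a parity bit in the last position. Let $D$ be the set of words of weight $16$ in $B$, let $\langle D\rangle\subseteq B$ be its linear span, and let $\mathbf 1$ be the all-ones word. Then $D$ consists of five words, and $\langle D\rangle$ has exactly $16$ cosets in $B$. Moreover, let $u_1,\dots,u_{16}\in B$ be any representatives of these cosets $u_i+\langle D\rangle$, and let $C$ be any $(20,8)$-code of size $256$ such that $d_H(x,y)$ is divisible by $4$ for all $x,y\in C$. Then there is a (possibly empty) set $S\subseteq\{1,\dots,16\}$ such that $C$ is equivalent to the code obtained from $B$ by replacing the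 coset $u_i+\langle D\rangle$ by $\mathbf 1+u_i+\langle D\rangle$ for each $i\in S$. -/

import Mathlib

/-- Binary words of length `n`, i.e. elements of `𝔽₂ⁿ`. -/
abbrev BinWord (n : ℕ) : Type := Fin n → ZMod 2

/-- An `(n, d)`-code: a set of binary words of length `n` in which any two distinct words
have Hamming distance at least `d`. -/
def IsBinaryCode (n d : ℕ) (C : Set (BinWord n)) : Prop :=
  ∀ x ∈ C, ∀ y ∈ C, x ≠ y → d ≤ hammingDist x y

/-- Two codes are equivalent if the second arises from the first by permuting the `n`
coordinates and then permuting the alphabet `{0, 1}` in each coordinate separately. -/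
def CodeEquivalent {n : ℕ} (C C' : Set (BinWord n)) : Prop :=
  ∃ (σ : Equiv.Perm (Fin n)) (τ : Fin n → Equiv.Perm (ZMod 2)),
    C' = (fun (x : BinWord n) (i : Fin n) => τ i (x (σ i))) '' C

/-- Coefficients, from the constant term upwards, of the generator polynomial
`1 + X² + X⁴ + X⁵ + X⁶ + X¹⁰ + X¹¹` of the cyclic binary Golay code of length 23. -/
def golayPoly : Fin 12 → ZMod 2 := ![1, 0, 1, 0, 1, 1, 1, 0, 0, 0, 1, 1]

/-- Row `i` of a generator matrix of the extended binary Golay code: positions `0, …, 22` hold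
the coefficients of `Xⁱ` times the generator polynomial, position `23` holds the parity bit,
which is `1` since the generator polynomial has seven nonzero coefficients. -/
def golayRow (i : Fin 12) : BinWord 24 := fun j =>
  if j.val = 23 then 1
  else if h : i.val ≤ j.val ∧ j.val - i.val < 12 then golayPoly ⟨j.val - i.val, h.2⟩
  else 0

/-- The extended binary Golay code. -/
def extendedGolay : Submodule (ZMod 2) (BinWord 24) :=
  Submodule.span (ZMod 2) (Set.range golayRow)

/-- The quadruply shortened extended binary Golay code: the words of the extended binary Golay
code that start with `0000`, with these first four positions removed. -/
def shortenedGolay : Submodule (ZMod 2) (BinWord 20) where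
  carrier := {v | ∃ w ∈ extendedGolay, (∀ i : Fin 4, w (Fin.castAdd 20 i) = 0) ∧
    ∀ i : Fin 20, w (Fin.natAdd 4 i) = v i}
  zero_mem' := ⟨0, extendedGolay.zero_mem, fun _ => rfl, fun _ => rfl⟩
  add_mem' := by
    rintro a b ⟨w, hw, hw0, hwa⟩ ⟨z, hz, hz0, hzb⟩
    exact ⟨w + z, extendedGolay.add_mem hw hz, fun i => by simp [hw0 i, hz0 i],
      fun i => by simp [hwa i, hzb i]⟩
  smul_mem' := by
    rintro c a ⟨w, hw, hw0, hwa⟩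
    exact ⟨c • w, extendedGolay.smul_mem c hw, fun i => by simp [hw0 i], fun i => by simp [hwa i]⟩

/-- The set `D` of words of weight 16 in the quadruply shortened extended binary Golay code. -/
def weightSixteenWords : Set (BinWord 20) := {v | v ∈ shortenedGolay ∧ hammingNorm v = 16}

/-- The linear span `⟨D⟩`. -/
def spanD : Submodule (ZMod 2) (BinWord 20) := Submodule.span (ZMod 2) weightSixteenWords

/-- `u₁, …, u₁₆` is a system of representatives for the cosets of `⟨D⟩` in the quadruply
shortened extended binary Golay code. -/
def IsCosetReps (u : Fin 16 → BinWord 20) : Prop :=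
  (∀ i, u i ∈ shortenedGolay) ∧ ∀ b ∈ shortenedGolay, ∃! i, b - u i ∈ spanD

/-- The coset `v + ⟨D⟩`. -/
def cosetD (v : BinWord 20) : Set (BinWord 20) := {x | ∃ y ∈ spanD, x = v + y}

/-- The code obtained from the quadruply shortened extended binary Golay code by replacing, for
each `i ∈ S`, the coset `uᵢ + ⟨D⟩` by `𝟏 + uᵢ + ⟨D⟩`, where `𝟏` is the all-ones word. -/
def replaceCosets (u : Fin 16 → BinWord 20) (S : Set (Fin 16)) : Set (BinWord 20) :=
  ((shortenedGolay : Set (BinWord 20)) \ ⋃ i ∈ S, cosetD (u i)) ∪ ⋃ i ∈ S, cosetD (1 + u i)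

open Finset

/-! Translate `C` so that it contains 0. Weights and distances are then divisible by 4, so the words
of `C` are pairwise orthogonal, and together with 𝟏 they span a doubly even linear code `E`,
although `C` itself need not be linear.

The dimension of `E` is 9. It is at least 8, as `E` contains 256 words, and less than 10, as length
20 admits no doubly even self-dual code (`IsDoublyEven.card_lt`). A second moment bound
(`IsDoublyEven.le_card_tetrads`) forces a word of weight 4 (a tetrad) in dimension 8, where `C = E`
has minimum distance 8, and five tetrads in dimension 9.

For a tetrad `t`, the sets `C` and `C + t` partition `E`: adding `t` flips membership in `C`. Hence
no two tetrads add up to a tetrad, so they are disjoint and cut the 20 coordinates into five blocks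
of size 4. Modulo block indicators, a word of `E` has a class in 𝔽₂² on each block, and these
classes form a code of length 5 with 16 words and minimum distance 4 over an alphabet of size 4.
Such an additive code is unique up to labelling, so `E` is a fixed standard code
(`IsTetradFrame.exists_labelling_of_frame`).

The standard code is also `B ∪ (𝟏 + B)` after an explicit labelling, and `⟨D⟩` consists of the even
combinations of blocks. Since each block flips membership in `C`, `C` is a union of cosets of `⟨D⟩`;
since 𝟏 is a sum of five blocks, `C` contains exactly one of `u + ⟨D⟩` and `𝟏 + u + ⟨D⟩` for each `u
∈ B`. -/

/-! ### Weights modulo four and orthogonality -/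

theorem hammingNorm_eq_sum_val {n : ℕ} (x : BinWord n) :
    hammingNorm x = ∑ i, (x i).val := by
  rw [hammingNorm, Finset.card_filter]
  refine Finset.sum_congr rfl fun i _ => ?_
  generalize x i = a
  revert a; decide

theorem hammingNorm_add_add_two_mul {n : ℕ} (x y : BinWord n) :
    hammingNorm (x + y) + 2 * ∑ i, (x i * y i).val = hammingNorm x + hammingNorm y := by
  simp only [hammingNorm_eq_sum_val, Finset.mul_sum, ← Finset.sum_add_distrib, Pi.add_apply]
  refine Finset.sum_congr rfl fun i _ => ?_
  generalize x i = a; generalize y i = b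
  revert a b; decide

theorem cast_sum_val_mul {n : ℕ} (x y : BinWord n) :
    ((∑ i, (x i * y i).val : ℕ) : ZMod 2) = x ⬝ᵥ y := by
  simp [dotProduct]

theorem cast_hammingNorm {n : ℕ} (x : BinWord n) : (hammingNorm x : ZMod 2) = x ⬝ᵥ 1 := by
  simp [hammingNorm_eq_sum_val, dotProduct]

/-- The weight of a sum is the sum of the weights minus twice the overlap, and the parity of the
overlap is the inner product. -/
theorem four_dvd_hammingNorm_add_iff {n : ℕ} {x y : BinWord n} (hx : 4 ∣ hammingNorm x)
    (hy : 4 ∣ hammingNorm y) : 4 ∣ hammingNorm (x + y) ↔ x ⬝ᵥ y = 0 := by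
  have h := hammingNorm_add_add_two_mul x y
  rw [← cast_sum_val_mul, ZMod.natCast_eq_zero_iff]
  omega

theorem hammingDist_eq_hammingNorm_add {n : ℕ} (x y : BinWord n) :
    hammingDist x y = hammingNorm (x + y) := by
  rw [hammingDist_eq_hammingNorm, show -x = x from ZModModule.neg_eq_self x]

/-- A doubly even code: all weights are divisible by four. -/
def IsDoublyEven {n : ℕ} (E : Submodule (ZMod 2) (BinWord n)) : Prop :=
  ∀ x ∈ E, 4 ∣ hammingNorm x

theorem IsDoublyEven.dotProduct_eq_zero {n : ℕ} {E : Submodule (ZMod 2) (BinWord n)}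
    (hE : IsDoublyEven E) {x y : BinWord n} (hx : x ∈ E) (hy : y ∈ E) : x ⬝ᵥ y = 0 :=
  (four_dvd_hammingNorm_add_iff (hE x hx) (hE y hy)).1 (hE _ (E.add_mem hx hy))

theorem isDoublyEven_span {n : ℕ} {G : Set (BinWord n)} (h4 : ∀ x ∈ G, 4 ∣ hammingNorm x)
    (hG : ∀ x ∈ G, ∀ y ∈ G, x ⬝ᵥ y = 0) : IsDoublyEven (Submodule.span (ZMod 2) G) := by
  have h1 : ∀ x ∈ G, ∀ y ∈ Submodule.span (ZMod 2) G, x ⬝ᵥ y = 0 := by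
    intro x hx y hy
    induction hy using Submodule.span_induction with
    | mem y hy => exact hG x hx y hy
    | zero => simp
    | add y z _ _ hy hz => rw [dotProduct_add, hy, hz, add_zero]
    | smul a y _ hy => rw [dotProduct_smul, hy, smul_zero]
  have h2 : ∀ x ∈ Submodule.span (ZMod 2) G, ∀ y ∈ Submodule.span (ZMod 2) G, x ⬝ᵥ y = 0 := by
    intro x hx y hy
    induction hx using Submodule.span_induction with
    | mem x hx => exact h1 x hx y hy
    | zero => simp
    | add x z _ _ hx hz => rw [add_dotProduct, hx, hz, add_zero]
    | smul a x _ hx => rw [smul_dotProduct, hx, smul_zero]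
  intro x hx
  induction hx using Submodule.span_induction with
  | mem x hx => exact h4 x hx
  | zero => simp
  | add x y hx hy ihx ihy => exact (four_dvd_hammingNorm_add_iff ihx ihy).2 (h2 x hx y hy)
  | smul a x _ hx =>
    obtain rfl | rfl : a = 0 ∨ a = 1 := by revert a; decide
    · simp
    · simpa using hx

/-! ### Character sums and dual codes -/

theorem neg_one_pow_val_add {R : Type*} [CommRing R] (a b : ZMod 2) :
    (-1 : R) ^ (a + b).val = (-1) ^ a.val * (-1) ^ b.val := by
  obtain rfl | rfl : a = 0 ∨ a = 1 := by revert a; decide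
  · simp
  · obtain rfl | rfl : b = 0 ∨ b = 1 := by revert b; decide
    · simp
    · have : (1 + 1 : ZMod 2) = 0 := by decide
      simp [this, ZMod.val_one]

/-- Orthogonality of characters: a nonzero functional is balanced on a linear code. -/
theorem sum_neg_one_pow_eq_zero {R : Type*} [CommRing R] [NoZeroDivisors R] (h2 : (2 : R) ≠ 0)
    {n : ℕ} (E : Submodule (ZMod 2) (BinWord n)) [Fintype E] (f : BinWord n →+ ZMod 2)
    {e : BinWord n} (he : e ∈ E) (hf : f e ≠ 0) :
    ∑ x : E, (-1 : R) ^ (f x).val = 0 := by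
  have h1 : f e = 1 := by revert hf; generalize f e = a; revert a; decide
  have key : ∑ x : E, (-1 : R) ^ (f x).val = ∑ x : E, -(-1 : R) ^ (f x).val := by
    rw [← Equiv.sum_comp (Equiv.addRight (⟨e, he⟩ : E))]
    refine Finset.sum_congr rfl fun x _ => ?_
    simp [neg_one_pow_val_add, h1, ZMod.val_one]
  rw [Finset.sum_neg_distrib, eq_neg_iff_add_eq_zero, ← two_mul] at key
  exact (mul_eq_zero.1 key).resolve_left h2

/-- The functional `y ↦ x ⬝ᵥ y`. -/
def dotHom {n : ℕ} (x : BinWord n) : BinWord n →+ ZMod 2 where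
  toFun y := x ⬝ᵥ y
  map_zero' := dotProduct_zero x
  map_add' := dotProduct_add x

@[simp] theorem dotHom_apply {n : ℕ} (x y : BinWord n) : dotHom x y = x ⬝ᵥ y := rfl

open Classical in
theorem sum_neg_one_pow_dotProduct {R : Type*} [CommRing R] [NoZeroDivisors R] (h2 : (2 : R) ≠ 0)
    {n : ℕ} (E : Submodule (ZMod 2) (BinWord n)) [Fintype E] (v : BinWord n) :
    ∑ x : E, (-1 : R) ^ (v ⬝ᵥ (x : BinWord n)).val =
      if ∀ x ∈ E, v ⬝ᵥ x = 0 then (Fintype.card E : R) else 0 := by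
  split_ifs with h
  · rw [Finset.sum_congr rfl fun (x : E) _ => by rw [h x x.2, ZMod.val_zero, pow_zero]]
    simp
  · push Not at h
    obtain ⟨e, he, hv⟩ := h
    exact sum_neg_one_pow_eq_zero h2 E (dotHom v) he hv

open Classical in
/-- A linear code and its dual have complementary sizes. -/
theorem card_mul_card_dual {n : ℕ} (E : Submodule (ZMod 2) (BinWord n)) [Fintype E] :
    Fintype.card E * (univ.filter fun v : BinWord n => ∀ x ∈ E, v ⬝ᵥ x = 0).card = 2 ^ n := by
  have h2 : (2 : ℤ) ≠ 0 := by norm_num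
  have h1 : ∑ v : BinWord n, ∑ x : E, (-1 : ℤ) ^ (v ⬝ᵥ (x : BinWord n)).val =
      Fintype.card E * (univ.filter fun v : BinWord n => ∀ x ∈ E, v ⬝ᵥ x = 0).card := by
    simp_rw [sum_neg_one_pow_dotProduct h2 E]
    rw [← Finset.sum_filter, Finset.sum_const, nsmul_eq_mul, mul_comm]
  have h3 : ∑ v : BinWord n, ∑ x : E, (-1 : ℤ) ^ (v ⬝ᵥ (x : BinWord n)).val = 2 ^ n := by
    rw [Finset.sum_comm, Finset.sum_eq_single (0 : E)]
    · simp
    · intro x _ hx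
      have hx' : ∃ i, (x : BinWord n) i ≠ 0 := by
        by_contra! h
        exact hx (Subtype.ext (funext h))
      obtain ⟨i, hi⟩ := hx'
      have := sum_neg_one_pow_eq_zero h2 (⊤ : Submodule (ZMod 2) (BinWord n)) (dotHom x)
        (e := Pi.single i 1) trivial (by simpa using hi)
      rw [← this]
      symm
      refine Fintype.sum_bijective (fun v : (⊤ : Submodule (ZMod 2) (BinWord n)) => (v : BinWord n))
        ⟨Subtype.val_injective, fun v => ⟨⟨v, Submodule.mem_top⟩, rfl⟩⟩ _ _ fun v => ?_
      simp [dotProduct_comm]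
    · simp
  exact_mod_cast h1.symm.trans h3

/-! ### Doubly even codes of length 20 have dimension at most 9 -/

/-- The field 𝔽₅ contains 2, a square root of −1, and so replaces the complex numbers in a Gauss sum
argument. -/
instance : Fact (Nat.Prime 5) := ⟨by norm_num⟩

/-- There is no doubly even self-dual code of length 20. -/
theorem IsDoublyEven.card_lt {E : Submodule (ZMod 2) (BinWord 20)} [Fintype E]
    (hE : IsDoublyEven E) : Fintype.card E < 1024 := by
  classical
  by_contra! hcard
  set P : Finset (BinWord 20) := univ.filter fun v => ∀ x ∈ E, v ⬝ᵥ x = 0 with hP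
  set Q : Finset (BinWord 20) := univ.filter fun v => v ∈ E with hQ
  have hQc : Q.card = Fintype.card E := by rw [hQ, Fintype.card_subtype]
  have hQP : Q ⊆ P := by
    intro v hv
    simp only [hQ, hP, mem_filter, mem_univ, true_and] at hv ⊢
    exact fun x hx => hE.dotProduct_eq_zero hv hx
  have hmul : Fintype.card E * P.card = 2 ^ 20 := card_mul_card_dual E
  have hle := Finset.card_le_card hQP
  have hPc : P.card = 1024 := by nlinarith
  have hEc : Fintype.card E = 1024 := by nlinarith
  have hPQ : Q = P := Finset.eq_of_subset_of_card_le hQP (by omega)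
  have h2 : (2 : ZMod 5) ≠ 0 := by decide
  have hone : ∀ x ∈ E, (2 : ZMod 5) ^ hammingNorm x = 1 := by
    intro x hx
    obtain ⟨k, hk⟩ := hE x hx
    rw [hk, pow_mul, show (2 : ZMod 5) ^ 4 = 1 by decide, one_pow]
  -- Since 2² = −1, the overlap term in the weight of `v + x` becomes a character of `x`.
  have hshift : ∀ v : BinWord 20, ∀ x ∈ E, (2 : ZMod 5) ^ hammingNorm (v + x) =
      2 ^ hammingNorm v * (-1) ^ (v ⬝ᵥ x).val := by
    intro v x hx
    have h := congrArg (fun k => (2 : ZMod 5) ^ k) (hammingNorm_add_add_two_mul v x)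
    simp only [pow_add, pow_mul, hone x hx, mul_one] at h
    rw [← h, mul_assoc, ← cast_sum_val_mul, ZMod.val_natCast, show (2 : ZMod 5) ^ 2 = -1 by decide,
      ← neg_one_pow_eq_pow_mod_two, ← pow_add, ← two_mul]
    simp
  -- The sum factors over coordinates as (1 + 2)²⁰, which is 1 in 𝔽₅.
  have hall : ∑ v : BinWord 20, (2 : ZMod 5) ^ hammingNorm v = 1 := by
    have h : ∀ v : BinWord 20, (2 : ZMod 5) ^ hammingNorm v = ∏ i, 2 ^ (v i).val := fun v => by
      rw [hammingNorm_eq_sum_val, Finset.prod_pow_eq_pow_sum]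
    simp_rw [h]
    rw [← Fintype.piFinset_univ, ← Finset.prod_univ_sum (fun _ => univ)
      (fun (_ : Fin 20) (a : ZMod 2) => (2 : ZMod 5) ^ a.val)]
    rw [Finset.prod_const]
    decide
  have hS : ∑ x : E, ∑ v : BinWord 20, (2 : ZMod 5) ^ hammingNorm (v + (x : BinWord 20)) = 1024 := by
    have h : ∀ x : BinWord 20, ∑ v : BinWord 20, (2 : ZMod 5) ^ hammingNorm (v + x) = 1 :=
      fun x => (Equiv.sum_comp (Equiv.addRight x) fun v => (2 : ZMod 5) ^ hammingNorm v).trans hall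
    simp [h, hEc]
  -- Summing over `E` first leaves only the `v` in the dual, which is `E`. The total is then 1024² =
  -- 1 in 𝔽₅, against 1024 = 4.
  rw [Finset.sum_comm] at hS
  rw [Finset.sum_congr rfl fun v _ => Finset.sum_congr rfl fun (x : E) _ => hshift v x x.2] at hS
  simp_rw [← Finset.mul_sum, sum_neg_one_pow_dotProduct h2 E, mul_ite, mul_zero] at hS
  rw [← Finset.sum_filter, ← hP, ← hPQ, Finset.sum_congr rfl fun x hx => by
    rw [hone x (by simpa [hQ] using hx), one_mul], Finset.sum_const, hQc, hEc, nsmul_eq_mul,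
    show ((1024 : ℕ) : ZMod 5) = 4 from rfl, show (1024 : ZMod 5) = 4 from rfl] at hS
  revert hS
  decide

/-! ### Second moments and the number of tetrads -/

/-- The second moment inequality for the weights of a linear code. -/
theorem card_mul_le_sum_sq {n : ℕ} (E : Submodule (ZMod 2) (BinWord n)) [Fintype E] :
    (Fintype.card E : ℤ) * n ≤ ∑ x : E, ((n : ℤ) - 2 * hammingNorm (x : BinWord n)) ^ 2 := by
  classical
  have hw : ∀ x : BinWord n, (n : ℤ) - 2 * hammingNorm x = ∑ i, (-1 : ℤ) ^ (x i).val := by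
    intro x
    have : ∀ a : ZMod 2, (-1 : ℤ) ^ a.val = 1 - 2 * a.val := by decide
    simp [this, hammingNorm_eq_sum_val, Finset.mul_sum]
  simp_rw [hw, sq, Finset.sum_mul_sum, ← neg_one_pow_val_add]
  rw [Finset.sum_comm]
  -- The square has been expanded over pairs of coordinates. Each pair contributes 0 or `|E|`, and
  -- the diagonal pair contributes `|E|`.
  have h : ∀ i : Fin n, (Fintype.card E : ℤ) ≤
      ∑ x : E, ∑ j, (-1 : ℤ) ^ ((x : BinWord n) i + (x : BinWord n) j).val := by
    intro i
    rw [Finset.sum_comm]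
    have hnn : ∀ j ∈ (univ : Finset (Fin n)),
        0 ≤ ∑ x : E, (-1 : ℤ) ^ ((x : BinWord n) i + (x : BinWord n) j).val := by
      intro j _
      have := sum_neg_one_pow_dotProduct (R := ℤ) (by norm_num) E (Pi.single i 1 + Pi.single j 1)
      simp only [add_dotProduct, single_dotProduct, one_mul] at this
      rw [this]
      split_ifs
      · positivity
      · exact le_rfl
    refine le_trans ?_ (Finset.single_le_sum hnn (mem_univ i))
    simp [CharTwo.add_self_eq_zero]
  calc (Fintype.card E : ℤ) * n = ∑ _i : Fin n, (Fintype.card E : ℤ) := by simp [mul_comm]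
    _ ≤ _ := Finset.sum_le_sum fun i _ => h i

theorem sum_val_one_mul {n : ℕ} (x : BinWord n) : ∑ i, ((1 : BinWord n) i * x i).val =
    hammingNorm x := by
  simp [hammingNorm_eq_sum_val]

theorem hammingNorm_one {n : ℕ} : hammingNorm (1 : BinWord n) = n := by
  simp [hammingNorm_eq_sum_val, ZMod.val_one]

theorem hammingNorm_one_add {n : ℕ} (x : BinWord n) :
    hammingNorm (1 + x) + hammingNorm x = n := by
  have h := hammingNorm_add_add_two_mul 1 x
  rw [sum_val_one_mul, hammingNorm_one] at h
  omega

theorem add_add_self {n : ℕ} (x y : BinWord n) : x + y + y = x := by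
  rw [add_assoc, ZModModule.add_self, add_zero]

open Classical in
/-- The words of weight four of a linear code. -/
noncomputable def tetrads {n : ℕ} (E : Submodule (ZMod 2) (BinWord n)) : Finset (BinWord n) :=
  univ.filter fun x => x ∈ E ∧ hammingNorm x = 4

theorem mem_tetrads {n : ℕ} {E : Submodule (ZMod 2) (BinWord n)} {x : BinWord n} :
    x ∈ tetrads E ↔ x ∈ E ∧ hammingNorm x = 4 := by
  classical simp [tetrads]

theorem card_filter_tetrads {n : ℕ} (E : Submodule (ZMod 2) (BinWord n)) [Fintype E] :
    (univ.filter fun x : E => hammingNorm (x : BinWord n) = 4).card = (tetrads E).card := by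
  classical
  refine Finset.card_bij (fun x _ => (x : BinWord n)) (fun x hx => ?_) (fun x _ y _ h => ?_)
    fun y hy => ?_
  · exact mem_tetrads.2 ⟨x.2, by simpa using hx⟩
  · exact Subtype.ext h
  · exact ⟨⟨y, (mem_tetrads.1 hy).1⟩, by simpa using (mem_tetrads.1 hy).2, rfl⟩

/-- The second moment inequality bounds the number of tetrads from below. -/
theorem IsDoublyEven.le_card_tetrads {E : Submodule (ZMod 2) (BinWord 20)} [Fintype E]
    (hE : IsDoublyEven E) (h1 : (1 : BinWord 20) ∈ E) :
    4 * Fintype.card E ≤ 768 + 256 * (tetrads E).card := by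
  classical
  -- The square is 400 at weights 0 and 20, 144 at weights 4 and 16, and 16 otherwise; 384 and 128
  -- are the excesses over 16. The terms in `1 + x` account for weights 20 and 16.
  have hpt : ∀ x : E, (((20 : ℕ) : ℤ) - 2 * hammingNorm (x : BinWord 20)) ^ 2 ≤
      16 + (if x = 0 then 384 else 0) + (if (⟨1, h1⟩ + x : E) = 0 then 384 else 0) +
      (if hammingNorm (x : BinWord 20) = 4 then 128 else 0) +
      (if hammingNorm ((⟨1, h1⟩ + x : E) : BinWord 20) = 4 then 128 else 0) := by
    rintro ⟨x, hx⟩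
    have hsum := hammingNorm_one_add x
    obtain ⟨k, hk⟩ := hE x hx
    simp only [AddMemClass.mk_add_mk, Submodule.mk_eq_zero, ← hammingNorm_eq_zero]
    obtain ⟨w, hw⟩ : ∃ w, hammingNorm (1 + x) = w := ⟨_, rfl⟩
    simp only [hw, hk] at hsum ⊢
    obtain rfl : w = 20 - 4 * k := by omega
    have hk5 : k ≤ 5 := by omega
    interval_cases k <;> norm_num
  have hcard : ∀ p : E → Prop, [DecidablePred p] → ∀ c : ℤ,
      ∑ x : E, (if p x then c else 0) = (univ.filter p).card * c := by
    intro p _ c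
    rw [← Finset.sum_filter, Finset.sum_const, nsmul_eq_mul]
  have hshift : ∀ F : E → ℤ, ∑ x : E, F (⟨1, h1⟩ + x) = ∑ x : E, F x :=
    Equiv.sum_comp (Equiv.addLeft (⟨1, h1⟩ : E))
  have h := (card_mul_le_sum_sq E).trans (Finset.sum_le_sum fun x _ => hpt x)
  simp only [Finset.sum_add_distrib] at h
  rw [hshift fun x => if x = 0 then 384 else 0,
    hshift fun x => if hammingNorm (x : BinWord 20) = 4 then 128 else 0] at h
  rw [hcard (fun x => hammingNorm (x : BinWord 20) = 4), card_filter_tetrads] at h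
  simp at h
  omega

theorem card_eq_two_pow_finrank {n : ℕ} (E : Submodule (ZMod 2) (BinWord n)) [Fintype E] :
    Fintype.card E = 2 ^ Module.finrank (ZMod 2) E := by
  rw [Module.card_eq_pow_finrank (K := ZMod 2)]
  simp [ZMod.card]

/-! ### The doubly even code spanned by a code -/

/-- A code of size 256, minimum distance 8 and distances divisible by four, containing zero, is
one half of a doubly even `[20, 9]` code, split by every word of weight four. -/
theorem exists_doublyEven_of_code {C : Set (BinWord 20)} (hC : IsBinaryCode 20 8 C)
    (h0 : (0 : BinWord 20) ∈ C) (hcard : C.ncard = 256)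
    (h4 : ∀ x ∈ C, ∀ y ∈ C, 4 ∣ hammingDist x y) :
    ∃ E : Submodule (ZMod 2) (BinWord 20), IsDoublyEven E ∧ (1 : BinWord 20) ∈ E ∧
      Module.finrank (ZMod 2) E = 9 ∧ C ⊆ E ∧
      ∀ t ∈ E, hammingNorm t = 4 → ∀ x ∈ E, x ∈ C ↔ x + t ∉ C := by
  classical
  have hw : ∀ x ∈ C, 4 ∣ hammingNorm x := fun x hx => by
    simpa [hammingDist_eq_hammingNorm_add] using h4 x hx 0 h0
  have horth : ∀ x ∈ C, ∀ y ∈ C, x ⬝ᵥ y = 0 := fun x hx y hy =>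
    (four_dvd_hammingNorm_add_iff (hw x hx) (hw y hy)).1
      (by simpa [hammingDist_eq_hammingNorm_add] using h4 x hx y hy)
  have hone : ∀ x : BinWord 20, 4 ∣ hammingNorm x → x ⬝ᵥ 1 = 0 := fun x hx => by
    rw [← cast_hammingNorm, ZMod.natCast_eq_zero_iff]
    omega
  have hwone : 4 ∣ hammingNorm (1 : BinWord 20) := by rw [hammingNorm_one]; norm_num
  set E := Submodule.span (ZMod 2) (insert 1 C) with hEdef
  have hE : IsDoublyEven E := by
    refine isDoublyEven_span ?_ ?_
    · rintro x (rfl | hx)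
      exacts [hwone, hw x hx]
    · rintro x (rfl | hx) y (rfl | hy)
      · exact hone _ hwone
      · rw [dotProduct_comm]
        exact hone _ (hw y hy)
      · exact hone _ (hw x hx)
      · exact horth x hx y hy
  have h1 : (1 : BinWord 20) ∈ E := Submodule.subset_span (Set.mem_insert _ _)
  have hCE : C ⊆ E := (Set.subset_insert _ _).trans Submodule.subset_span
  have hnot : ∀ t, hammingNorm t = 4 → ∀ x ∈ C, x + t ∉ C := by
    intro t ht x hx hxt
    have hd : hammingDist x (x + t) = 4 := by
      rw [hammingDist_eq_hammingNorm_add, ← add_assoc, ZModModule.add_self, zero_add, ht]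
    have := hC x hx (x + t) hxt fun h => by
      rw [← h, hammingDist_self] at hd
      omega
    omega
  have hEc : (E : Set (BinWord 20)).ncard = Fintype.card E := by
    rw [← Nat.card_coe_set_eq, ← Nat.card_eq_fintype_card]; rfl
  have hge : 256 ≤ Fintype.card E := by
    rw [← hcard, ← hEc]
    exact Set.ncard_le_ncard hCE (Set.toFinite _)
  have hpow := card_eq_two_pow_finrank E
  have hlt := hE.card_lt
  -- With 256 words `E` would equal `C`, but the tetrad bound 4 · 256 ≤ 768 + 256 · #tetrads yields
  -- a tetrad, at distance 4 from 0.
  have hne : Fintype.card E ≠ 256 := by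
    intro h
    have hEq : C = E := Set.eq_of_subset_of_ncard_le hCE (by omega) (Set.toFinite _)
    have hle := hE.le_card_tetrads h1
    have hpos : 0 < (tetrads E).card := by omega
    obtain ⟨t, ht⟩ := Finset.card_pos.1 hpos
    obtain ⟨htE, ht4⟩ := mem_tetrads.1 ht
    refine hnot t ht4 0 h0 ?_
    rw [hEq, zero_add]
    exact htE
  have hk : Module.finrank (ZMod 2) E = 9 := by
    generalize Module.finrank (ZMod 2) E = k at hpow
    rw [hpow] at hge hlt hne
    have hk1 : 8 ≤ k := by
      by_contra! hk
      have := Nat.pow_le_pow_right (n := 2) (by norm_num) (show k ≤ 7 by omega)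
      omega
    have hk2 : k < 10 := by
      by_contra! hk
      have := Nat.pow_le_pow_right (n := 2) (by norm_num) hk
      omega
    have hk3 : k ≠ 8 := by rintro rfl; omega
    omega
  refine ⟨E, hE, h1, hk, hCE, fun t ht ht4 x hx => ⟨hnot t ht4 x, fun hxt => ?_⟩⟩
  -- Two disjoint sets of 256 words fill `E`, which has 512.
  have hdisj : Disjoint C ((· + t) '' C) := by
    rw [Set.disjoint_left]
    rintro _ hy ⟨x, hx, rfl⟩
    exact hnot t ht4 x hx hy
  have hinj : Function.Injective fun x : BinWord 20 => x + t := add_left_injective t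
  have himg : ((· + t) '' C).ncard = 256 := by rw [Set.ncard_image_of_injective _ hinj, hcard]
  have hun : C ∪ (· + t) '' C = E := by
    refine Set.eq_of_subset_of_ncard_le (Set.union_subset hCE ?_) ?_ (Set.toFinite _)
    · rintro _ ⟨x, hx, rfl⟩
      exact E.add_mem (hCE hx) ht
    · rw [Set.ncard_union_eq hdisj, hcard, himg, hEc, hpow, hk]
      norm_num
  have hx' : x ∈ C ∪ (· + t) '' C := by rw [hun]; exact hx
  rcases hx' with hx' | ⟨y, hy, rfl⟩
  · exact hx'
  · refine absurd ?_ hxt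
    simpa [add_add_self] using hy

/-! ### Tetrad frames -/

/-- The indicator of the `j`-th block of a partition of the coordinates into five blocks. -/
def blockWord (f : Fin 5 × Fin 4 ≃ Fin 20) (j : Fin 5) : BinWord 20 :=
  fun i => if (f.symm i).1 = j then 1 else 0

theorem blockWord_apply (f : Fin 5 × Fin 4 ≃ Fin 20) (j j' : Fin 5) (k : Fin 4) :
    blockWord f j (f (j', k)) = if j' = j then 1 else 0 := by
  simp [blockWord]

/-- The words of weight four of `E` are exactly the five blocks of the partition `f`. -/
structure IsTetradFrame (E : Submodule (ZMod 2) (BinWord 20)) (f : Fin 5 × Fin 4 ≃ Fin 20) :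
    Prop where
  doublyEven : IsDoublyEven E
  blockWord_mem : ∀ j, blockWord f j ∈ E
  eq_blockWord : ∀ t ∈ E, hammingNorm t = 4 → ∃ j, t = blockWord f j

/-- The second moment bound gives at least five tetrads. They have pairwise disjoint supports, so
there are exactly five and they cover all 20 coordinates. -/
theorem exists_isTetradFrame {E : Submodule (ZMod 2) (BinWord 20)} (hE : IsDoublyEven E)
    (h1 : (1 : BinWord 20) ∈ E) (hk : Module.finrank (ZMod 2) E = 9)
    (hadd : ∀ t ∈ E, ∀ t' ∈ E, hammingNorm t = 4 → hammingNorm t' = 4 → hammingNorm (t + t') ≠ 4) :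
    ∃ f, IsTetradFrame E f := by
  classical
  have hge : 5 ≤ (tetrads E).card := by
    have := hE.le_card_tetrads h1
    rw [card_eq_two_pow_finrank, hk] at this
    omega
  let supp : BinWord 20 → Finset (Fin 20) := fun x => univ.filter fun i => x i ≠ 0
  have hsupp : ∀ t ∈ tetrads E, (supp t).card = 4 := fun t ht => (mem_tetrads.1 ht).2
  have hdisj : ((tetrads E : Finset (BinWord 20)) : Set (BinWord 20)).PairwiseDisjoint supp := by
    intro t ht t' ht' hne
    obtain ⟨ht, ht4⟩ := mem_tetrads.1 ht
    obtain ⟨ht', ht4'⟩ := mem_tetrads.1 ht'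
    have hs := hammingNorm_add_add_two_mul t t'
    have h4 := hE _ (E.add_mem ht ht')
    have hne4 := hadd t ht t' ht' ht4 ht4'
    have hne0 : hammingNorm (t + t') ≠ 0 := by
      rw [hammingNorm_ne_zero_iff]
      intro h
      have h' := add_add_self t t'
      rw [h, zero_add] at h'
      exact hne h'.symm
    -- The weight of `t + t'` is 8 minus twice the overlap; being a multiple of 4 other than 0 and
    -- 4, it is 8.
    have hz : ∑ i, (t i * t' i).val = 0 := by omega
    rw [Finset.sum_eq_zero_iff] at hz
    change Disjoint (supp t) (supp t')
    rw [Finset.disjoint_left]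
    intro i hi hi'
    have := (ZMod.val_eq_zero _).1 (hz i (mem_univ i))
    rcases mul_eq_zero.1 this with h | h
    · simp [supp, h] at hi
    · simp [supp, h] at hi'
  have hle : (tetrads E).card * 4 ≤ 20 := by
    have := Finset.card_le_univ ((tetrads E).biUnion supp)
    rw [Finset.card_biUnion hdisj, Finset.sum_congr rfl hsupp, Finset.sum_const] at this
    simpa using this
  have h5 : (tetrads E).card = 5 := by omega
  obtain ⟨T⟩ : Nonempty (Fin 5 ≃ tetrads E) := ⟨(Finset.equivFinOfCardEq h5).symm⟩
  let g : ∀ j, Fin 4 ≃ supp (T j) := fun j =>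
    (Finset.equivFinOfCardEq (hsupp (T j) (T j).2)).symm
  let F : Fin 5 × Fin 4 → Fin 20 := fun p => g p.1 p.2
  have hmem : ∀ p : Fin 5 × Fin 4, F p ∈ supp (T p.1) := fun p => (g p.1 p.2).2
  have hblock : ∀ j i, i ∈ supp (T j) → ∀ j', i ∈ supp (T j') → j = j' := by
    intro j i hi j' hi'
    by_contra hne
    exact Finset.disjoint_left.1 (hdisj (T j).2 (T j').2
      fun h => hne (T.injective (Subtype.ext h))) hi hi'
  have hinj : Function.Injective F := by
    rintro ⟨j, k⟩ ⟨j', k'⟩ h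
    obtain rfl : j = j' := hblock j _ (hmem (j, k)) j' (by rw [h]; exact hmem (j', k'))
    have : k = k' := (g j).injective (Subtype.ext h)
    rw [this]
  have hbij : Function.Bijective F := (Fintype.bijective_iff_injective_and_card F).2
    ⟨hinj, by simp⟩
  let f := Equiv.ofBijective F hbij
  have hT : ∀ j, blockWord f j = T j := by
    intro j
    funext i
    obtain ⟨⟨j', k⟩, rfl⟩ := f.surjective i
    rw [blockWord_apply]
    have hm : f (j', k) ∈ supp (T j') := hmem (j', k)
    have hz : ∀ a : ZMod 2, a ≠ 0 → 1 = a := by decide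
    split_ifs with h
    · subst h
      exact hz _ (by simpa [supp] using hm)
    · by_contra h0
      exact h (hblock j' _ hm j (by simpa [supp] using Ne.symm h0))
  refine ⟨f, hE, fun j => ?_, fun t ht ht4 => ?_⟩
  · rw [hT]
    exact (mem_tetrads.1 (T j).2).1
  · have htm : t ∈ tetrads E := by
      rw [mem_tetrads]
      exact ⟨ht, ht4⟩
    obtain ⟨j, hj⟩ := T.surjective ⟨t, htm⟩
    exact ⟨j, by rw [hT, hj]⟩

/-! ### The standard code and its uniqueness -/

/-- Coordinates of the standard code: five blocks, each a copy of `𝔽₂²`. -/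
abbrev BlockCoord : Type := Fin 5 × ZMod 2 × ZMod 2

/-- The words of the standard `[20, 9]` code. -/
def stdWord : (Fin 9 → ZMod 2) →ₗ[ZMod 2] (BlockCoord → ZMod 2) where
  toFun m := fun p =>
    -- The first five parameters are constants on the blocks. On blocks 2, 3, 4 the pair `(m 7, m
    -- 8)` enters through 1, ω, ω², where ω is a linear map of order 3 on 𝔽₂²: this is a code of
    -- lines over 𝔽₄.
    ![m 0 + m 5 * p.2.1 + m 6 * p.2.2,
      m 1 + m 7 * p.2.1 + m 8 * p.2.2,
      m 2 + (m 5 + m 7) * p.2.1 + (m 6 + m 8) * p.2.2,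
      m 3 + (m 5 + m 8) * p.2.1 + (m 6 + m 7 + m 8) * p.2.2,
      m 4 + (m 5 + m 7 + m 8) * p.2.1 + (m 6 + m 7) * p.2.2] p.1
  map_add' m m' := by
    funext ⟨j, s, t⟩
    fin_cases j <;> simp <;> ring
  map_smul' c m := by
    funext ⟨j, s, t⟩
    fin_cases j <;> simp <;> ring

theorem stdWord_injective : Function.Injective stdWord := by
  rw [injective_iff_map_eq_zero]
  intro m hm
  have h : ∀ p, stdWord m p = 0 := fun p => by rw [hm]; rfl
  have h0 : ∀ j, stdWord m (j, 0, 0) = 0 := fun j => h _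
  have c0 := h0 0
  have c1 := h0 1
  have c2 := h0 2
  have c3 := h0 3
  have c4 := h0 4
  have c5 := h (0, 1, 0)
  have c6 := h (0, 0, 1)
  have c7 := h (1, 1, 0)
  have c8 := h (1, 0, 1)
  simp [stdWord] at c0 c1 c2 c3 c4 c5 c6 c7 c8
  simp only [c0, c1, zero_add] at c5 c6 c7 c8
  funext i
  fin_cases i <;> assumption

/-- The class of a word in block `j` modulo constants. -/
def cls (f : Fin 5 × Fin 4 ≃ Fin 20) (j : Fin 5) : BinWord 20 →ₗ[ZMod 2] ZMod 2 × ZMod 2 where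
  toFun x := (x (f (j, 0)) + x (f (j, 1)), x (f (j, 0)) + x (f (j, 2)))
  map_add' x y := by ext <;> simp <;> ring
  map_smul' c x := by ext <;> simp <;> ring

theorem sum_frame {M : Type*} [AddCommMonoid M] (f : Fin 5 × Fin 4 ≃ Fin 20) (F : Fin 20 → M) :
    ∑ i, F i = ∑ j, ∑ k, F (f (j, k)) := by
  rw [← Equiv.sum_comp f, Fintype.sum_prod_type]

namespace IsTetradFrame

variable {E : Submodule (ZMod 2) (BinWord 20)} {f : Fin 5 × Fin 4 ≃ Fin 20}

theorem sum_block (h : IsTetradFrame E f) {e : BinWord 20} (he : e ∈ E) (j : Fin 5) :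
    e (f (j, 0)) + e (f (j, 1)) + e (f (j, 2)) + e (f (j, 3)) = 0 := by
  have := h.doublyEven.dotProduct_eq_zero (h.blockWord_mem j) he
  rw [dotProduct, sum_frame f] at this
  simpa [blockWord_apply, Finset.sum_ite_eq, ← Finset.mul_sum, Fin.sum_univ_four] using this

theorem eq_of_cls_eq_zero (h : IsTetradFrame E f) {e : BinWord 20} (he : e ∈ E) {j : Fin 5}
    (hj : cls f j e = 0) (k : Fin 4) : e (f (j, k)) = e (f (j, 0)) := by
  have hs := h.sum_block he j
  have hj' : (e (f (j, 0)) + e (f (j, 1)), e (f (j, 0)) + e (f (j, 2))) = 0 := hj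
  have key : ∀ a b c d : ZMod 2, a + b + c + d = 0 → (a + b, a + c) = 0 →
      b = a ∧ c = a ∧ d = a := by decide
  obtain ⟨h1, h2, h3⟩ := key _ _ _ _ hs hj'
  fin_cases k
  exacts [rfl, h1, h2, h3]

theorem mem_of_block_const (h : IsTetradFrame E f) {x : BinWord 20}
    (hx : ∀ j k, x (f (j, k)) = x (f (j, 0))) : x ∈ E := by
  have : x = ∑ j, x (f (j, 0)) • blockWord f j := by
    funext i
    obtain ⟨⟨j, k⟩, rfl⟩ := f.surjective i
    simp [blockWord_apply, hx j k]
  rw [this]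
  exact E.sum_mem fun j _ => E.smul_mem _ (h.blockWord_mem j)

/-- A word of `E` is nonconstant on exactly zero or four blocks. -/
theorem card_cls_ne_zero (h : IsTetradFrame E f) {e : BinWord 20} (he : e ∈ E) :
    (univ.filter fun j => cls f j e ≠ 0).card = 0 ∨
      (univ.filter fun j => cls f j e ≠ 0).card = 4 := by
  have hle : (univ.filter fun j => cls f j e ≠ 0).card ≤ 5 := by
    simpa using Finset.card_le_univ (univ.filter fun j => cls f j e ≠ 0)
  -- Adding blocks clears the first point of each block. By even parity every nonconstant block then
  -- carries exactly two ones.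
  set x : BinWord 20 := e + ∑ j, e (f (j, 0)) • blockWord f j with hxdef
  have hxE : x ∈ E :=
    E.add_mem he (E.sum_mem fun j _ => E.smul_mem _ (h.blockWord_mem j))
  have hx : ∀ j k, x (f (j, k)) = e (f (j, k)) + e (f (j, 0)) := by
    intro j k
    simp [hxdef, blockWord_apply]
  have hw : hammingNorm x = 2 * (univ.filter fun j => cls f j e ≠ 0).card := by
    rw [hammingNorm_eq_sum_val, sum_frame f, Finset.card_filter, Finset.mul_sum]
    refine Finset.sum_congr rfl fun j _ => ?_
    simp only [hx, Fin.sum_univ_four]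
    have hs := h.sum_block he j
    change _ = 2 * if (e (f (j, 0)) + e (f (j, 1)), e (f (j, 0)) + e (f (j, 2))) ≠ 0 then 1 else 0
    generalize e (f (j, 0)) = a at *
    generalize e (f (j, 1)) = b at *
    generalize e (f (j, 2)) = c at *
    generalize e (f (j, 3)) = d at *
    clear_value x
    clear hx hxE hxdef hle
    revert a b c d
    decide
  have h4 := h.doublyEven x hxE
  -- A tetrad is a block, hence 1 at the first point of that block, where `x` vanishes.
  have hne : hammingNorm x ≠ 4 := by
    intro h4
    obtain ⟨j, hj⟩ := h.eq_blockWord x hxE h4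
    have h0 := hx j 0
    rw [hj, blockWord_apply, ZModModule.add_self] at h0
    simp at h0
  omega

/-- Two zero classes leave at most three nonzero ones, which is fewer than four. This is the minimum
distance of the code of classes. -/
theorem cls_eq_zero_of_two (h : IsTetradFrame E f) {e : BinWord 20} (he : e ∈ E) {i j : Fin 5}
    (hij : i ≠ j) (hi : cls f i e = 0) (hj : cls f j e = 0) (k : Fin 5) : cls f k e = 0 := by
  by_contra hk
  have h4 : (univ.filter fun j => cls f j e ≠ 0).card = 4 := by
    refine (h.card_cls_ne_zero he).resolve_left fun h0 => ?_
    rw [Finset.card_eq_zero] at h0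
    have : k ∈ univ.filter fun j => cls f j e ≠ 0 := by simpa using hk
    rw [h0] at this
    simp at this
  have hsub : (univ.filter fun j => cls f j e ≠ 0) ⊆ (univ.erase i).erase j := by
    intro l hl
    rw [mem_filter] at hl
    simp only [mem_erase, mem_univ, and_true]
    exact ⟨by rintro rfl; exact hl.2 hj, by rintro rfl; exact hl.2 hi⟩
  have := Finset.card_le_card hsub
  rw [h4, Finset.card_erase_of_mem (by simp [hij.symm]), Finset.card_erase_of_mem (by simp)] at this
  simp at this

theorem cls_ne_zero (h : IsTetradFrame E f) {e : BinWord 20} (he : e ∈ E) {i j k : Fin 5}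
    (hi : cls f i e = 0) (hj : cls f j e ≠ 0) (hik : i ≠ k) : cls f k e ≠ 0 := fun hk =>
  hj (h.cls_eq_zero_of_two he hik hi hk j)

/-- The classes in two blocks can be prescribed. -/
theorem exists_cls_eq (h : IsTetradFrame E f) (hk : Module.finrank (ZMod 2) E = 9) {i j : Fin 5}
    (hij : i ≠ j) (a b : ZMod 2 × ZMod 2) : ∃ e ∈ E, cls f i e = a ∧ cls f j e = b := by
  let Φ : E →ₗ[ZMod 2] (ZMod 2 × ZMod 2) × (ZMod 2 × ZMod 2) :=
    ((cls f i).prod (cls f j)).comp E.subtype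
  let ev : BinWord 20 →ₗ[ZMod 2] (Fin 5 → ZMod 2) := LinearMap.funLeft (ZMod 2) (ZMod 2)
    fun l => f (l, 0)
  let Ψ : LinearMap.ker Φ →ₗ[ZMod 2] (Fin 5 → ZMod 2) :=
    (ev.comp E.subtype).comp (LinearMap.ker Φ).subtype
  -- A word with zero classes in two blocks is constant on all five, hence given by five bits. The
  -- kernel has dimension at most 5, so the range has dimension 9 − 5 = 4.
  have hinj : Function.Injective Ψ := by
    rw [injective_iff_map_eq_zero]
    rintro ⟨⟨e, he⟩, hΦ⟩ h0
    have hΦ' : (cls f i e, cls f j e) = 0 := hΦ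
    rw [Prod.mk_eq_zero] at hΦ'
    have hcls := h.cls_eq_zero_of_two he hij hΦ'.1 hΦ'.2
    have he0 : e = 0 := by
      funext x
      obtain ⟨⟨l, k⟩, rfl⟩ := f.surjective x
      rw [h.eq_of_cls_eq_zero he (hcls l) k]
      exact congrFun h0 l
    exact Subtype.ext (Subtype.ext he0)
  have hker := LinearMap.finrank_le_finrank_of_injective hinj
  have hrn := LinearMap.finrank_range_add_finrank_ker Φ
  rw [Module.finrank_fin_fun] at hker
  have hle := Submodule.finrank_le (LinearMap.range Φ)
  have hfull : Module.finrank (ZMod 2) ((ZMod 2 × ZMod 2) × (ZMod 2 × ZMod 2)) = 4 := by simp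
  have htop : LinearMap.range Φ = ⊤ := Submodule.eq_top_of_finrank_eq (by omega)
  obtain ⟨e, he⟩ := LinearMap.range_eq_top.1 htop (a, b)
  have he' : (cls f i e, cls f j e) = (a, b) := he
  rw [Prod.mk.injEq] at he'
  exact ⟨e, e.2, he'⟩

end IsTetradFrame

/-- The label of a coordinate: its block, together with the values of two words on it. -/
def frameLabel (f : Fin 5 × Fin 4 ≃ Fin 20) (p₁ p₂ q₁ q₂ : BinWord 20) (i : Fin 20) : BlockCoord :=
  ((f.symm i).1, if (f.symm i).1 = 1 then q₁ i else p₁ i, if (f.symm i).1 = 1 then q₂ i else p₂ i)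

namespace IsTetradFrame

variable {E : Submodule (ZMod 2) (BinWord 20)} {f : Fin 5 × Fin 4 ≃ Fin 20}

/-- Two words with distinct nonzero classes separate the points of a block. -/
theorem separates_block (h : IsTetradFrame E f) {p q : BinWord 20} (hp : p ∈ E) (hq : q ∈ E)
    {j : Fin 5} (hp0 : cls f j p ≠ 0) (hq0 : cls f j q ≠ 0) (hpq : cls f j p ≠ cls f j q)
    {k l : Fin 4} (h1 : p (f (j, k)) = p (f (j, l))) (h2 : q (f (j, k)) = q (f (j, l))) :
    k = l := by
  -- Two distinct nonzero vectors of 𝔽₂² form a basis, so the two words serve as affine coordinates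
  -- on the four points.
  have key : ∀ a0 a1 a2 b0 b1 b2 : ZMod 2, (a0 + a1, a0 + a2) ≠ 0 → (b0 + b1, b0 + b2) ≠ 0 →
      (a0 + a1, a0 + a2) ≠ (b0 + b1, b0 + b2) → ∀ k l : Fin 4,
      (![a0, a1, a2, a0 + a1 + a2] k = ![a0, a1, a2, a0 + a1 + a2] l) →
      (![b0, b1, b2, b0 + b1 + b2] k = ![b0, b1, b2, b0 + b1 + b2] l) → k = l := by
    decide +kernel
  have hval : ∀ x ∈ E, ∀ k, x (f (j, k)) = ![x (f (j, 0)), x (f (j, 1)), x (f (j, 2)),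
      x (f (j, 0)) + x (f (j, 1)) + x (f (j, 2))] k := by
    intro x hx k
    have hs := h.sum_block hx j
    fin_cases k
    · rfl
    · rfl
    · rfl
    · exact (CharTwo.add_eq_zero.1 hs).symm
  rw [hval p hp k, hval p hp l] at h1
  rw [hval q hq k, hval q hq l] at h2
  exact key _ _ _ _ _ _ hp0 hq0 hpq k l h1 h2

/-- Words with the classes of the standard generators identify `E` with the standard code. -/
theorem exists_labelling (h : IsTetradFrame E f) (hk : Module.finrank (ZMod 2) E = 9)
    {p₁ p₂ q₁ q₂ : BinWord 20} (hp₁ : p₁ ∈ E) (hp₂ : p₂ ∈ E) (hq₁ : q₁ ∈ E) (hq₂ : q₂ ∈ E)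
    (hp : ∀ j ≠ 1, cls f j p₁ ≠ 0 ∧ cls f j p₂ ≠ 0 ∧ cls f j p₁ ≠ cls f j p₂)
    (hq : cls f 1 q₁ ≠ 0 ∧ cls f 1 q₂ ≠ 0 ∧ cls f 1 q₁ ≠ cls f 1 q₂)
    (hp₁1 : cls f 1 p₁ = 0) (hp₂1 : cls f 1 p₂ = 0) (hq₁0 : cls f 0 q₁ = 0) (hq₂0 : cls f 0 q₂ = 0)
    (hq₁2 : cls f 2 q₁ = cls f 2 p₁) (hq₂2 : cls f 2 q₂ = cls f 2 p₂)
    (hq₁3 : cls f 3 q₁ = cls f 3 p₂) (hq₂3 : cls f 3 q₂ = cls f 3 p₁ + cls f 3 p₂)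
    (hq₁4 : cls f 4 q₁ = cls f 4 p₁ + cls f 4 p₂) (hq₂4 : cls f 4 q₂ = cls f 4 p₁) :
    ∃ lam : Fin 20 ≃ BlockCoord, ∀ x, x ∈ E ↔ ∃ m, x = stdWord m ∘ lam := by
  have hinj : Function.Injective (frameLabel f p₁ p₂ q₁ q₂) := by
    intro i i' hii
    obtain ⟨⟨j, k⟩, rfl⟩ := f.surjective i
    obtain ⟨⟨j', k'⟩, rfl⟩ := f.surjective i'
    simp only [frameLabel, Equiv.symm_apply_apply, Prod.mk.injEq] at hii
    obtain ⟨rfl, h1, h2⟩ := hii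
    by_cases hj : j = 1
    · subst hj
      rw [if_pos rfl, if_pos rfl] at h1 h2
      rw [h.separates_block hq₁ hq₂ hq.1 hq.2.1 hq.2.2 h1 h2]
    · rw [if_neg hj, if_neg hj] at h1 h2
      rw [h.separates_block hp₁ hp₂ (hp j hj).1 (hp j hj).2.1 (hp j hj).2.2 h1 h2]
  have hbij : Function.Bijective (frameLabel f p₁ p₂ q₁ q₂) :=
    (Fintype.bijective_iff_injective_and_card _).2 ⟨hinj, by simp⟩
  let lam := Equiv.ofBijective _ hbij
  have hlam : ∀ j k, lam (f (j, k)) = (j, if j = 1 then q₁ (f (j, k)) else p₁ (f (j, k)),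
      if j = 1 then q₂ (f (j, k)) else p₂ (f (j, k))) := by
    intro j k
    simp [lam, frameLabel]
  have const : ∀ {x}, x ∈ E → ∀ {j}, cls f j x = 0 → ∀ k, x (f (j, k)) = x (f (j, 0)) :=
    fun hx _ hj k => h.eq_of_cls_eq_zero hx hj k
  -- Adding the matching combination of `p₁, p₂, q₁, q₂` leaves a word constant on blocks.
  -- Injectivity and dimension 9 then give all of `E`.
  have hcomp : ∀ m, stdWord m ∘ lam ∈ E := by
    intro m
    have hx : m 5 • p₁ + m 6 • p₂ + m 7 • q₁ + m 8 • q₂ ∈ E := by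
      refine E.add_mem (E.add_mem (E.add_mem ?_ ?_) ?_) ?_ <;> apply E.smul_mem <;> assumption
    refine (E.add_mem_iff_left hx).1 (h.mem_of_block_const fun j k => ?_)
    have two : (2 : ZMod 2) = 0 := rfl
    simp only [Function.comp_apply, Pi.add_apply, hlam, Pi.smul_apply, smul_eq_mul]
    fin_cases j
    · have c1 := const hq₁ hq₁0 k
      have c2 := const hq₂ hq₂0 k
      simp [stdWord] at c1 c2 ⊢
      linear_combination m 7 * c1 + m 8 * c2 + (m 5 * (p₁ (f (0, k)) - p₁ (f (0, 0))) +
        m 6 * (p₂ (f (0, k)) - p₂ (f (0, 0)))) * two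
    · have c1 := const hp₁ hp₁1 k
      have c2 := const hp₂ hp₂1 k
      simp [stdWord] at c1 c2 ⊢
      linear_combination m 5 * c1 + m 6 * c2 + (m 7 * (q₁ (f (1, k)) - q₁ (f (1, 0))) +
        m 8 * (q₂ (f (1, k)) - q₂ (f (1, 0)))) * two
    · have c1 := const (E.add_mem hq₁ hp₁)
        (by rw [map_add, hq₁2, ZModModule.add_self] : cls f 2 (q₁ + p₁) = 0) k
      have c2 := const (E.add_mem hq₂ hp₂)
        (by rw [map_add, hq₂2, ZModModule.add_self] : cls f 2 (q₂ + p₂) = 0) k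
      simp [stdWord] at c1 c2 ⊢
      linear_combination m 7 * c1 + m 8 * c2 + (m 5 * (p₁ (f (2, k)) - p₁ (f (2, 0))) +
        m 6 * (p₂ (f (2, k)) - p₂ (f (2, 0)))) * two
    · have c1 := const (E.add_mem hq₁ hp₂)
        (by rw [map_add, hq₁3, ZModModule.add_self] : cls f 3 (q₁ + p₂) = 0) k
      have c2 := const (E.add_mem hq₂ (E.add_mem hp₁ hp₂))
        (by rw [map_add, hq₂3, map_add, ZModModule.add_self] : cls f 3 (q₂ + (p₁ + p₂)) = 0) k
      simp [stdWord] at c1 c2 ⊢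
      linear_combination m 7 * c1 + m 8 * c2 + (m 5 * (p₁ (f (3, k)) - p₁ (f (3, 0))) +
        m 6 * (p₂ (f (3, k)) - p₂ (f (3, 0)))) * two
    · have c1 := const (E.add_mem hq₁ (E.add_mem hp₁ hp₂))
        (by rw [map_add, hq₁4, map_add, ZModModule.add_self] : cls f 4 (q₁ + (p₁ + p₂)) = 0) k
      have c2 := const (E.add_mem hq₂ hp₁)
        (by rw [map_add, hq₂4, ZModModule.add_self] : cls f 4 (q₂ + p₁) = 0) k
      simp [stdWord] at c1 c2 ⊢
      linear_combination m 7 * c1 + m 8 * c2 + (m 5 * (p₁ (f (4, k)) - p₁ (f (4, 0))) +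
        m 6 * (p₂ (f (4, k)) - p₂ (f (4, 0)))) * two
  let L : (Fin 9 → ZMod 2) →ₗ[ZMod 2] BinWord 20 :=
    (LinearMap.funLeft (ZMod 2) (ZMod 2) lam).comp stdWord
  have hL : Function.Injective L :=
    (LinearMap.funLeft_injective_of_surjective (ZMod 2) (ZMod 2) _ lam.surjective).comp stdWord_injective
  have hrange : LinearMap.range L = E := by
    refine Submodule.eq_of_le_of_finrank_eq ?_ ?_
    · rintro _ ⟨m, rfl⟩
      exact hcomp m
    · rw [LinearMap.finrank_range_of_inj hL, hk, Module.finrank_fin_fun]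
  refine ⟨lam, fun x => ?_⟩
  rw [← hrange, LinearMap.mem_range]
  exact exists_congr fun m => eq_comm

/-- A tetrad frame stays one when the blocks are renumbered. -/
theorem reindex (h : IsTetradFrame E f) (π : Equiv.Perm (Fin 5)) :
    IsTetradFrame E ((π.prodCongr (Equiv.refl (Fin 4))).trans f) := by
  have hb : ∀ j, blockWord ((π.prodCongr (Equiv.refl (Fin 4))).trans f) j = blockWord f (π j) := by
    intro j
    funext i
    simp [blockWord, Equiv.symm_apply_eq]
  refine ⟨h.doublyEven, fun j => ?_, fun t ht ht4 => ?_⟩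
  · rw [hb]
    exact h.blockWord_mem _
  · obtain ⟨j, hj⟩ := h.eq_blockWord t ht ht4
    exact ⟨π.symm j, by rw [hb, Equiv.apply_symm_apply, hj]⟩

/-- Doubly even `[20, 9]` codes with a tetrad frame are unique up to the order of coordinates. -/
theorem exists_labelling_of_frame (h : IsTetradFrame E f) (hk : Module.finrank (ZMod 2) E = 9) :
    ∃ lam : Fin 20 ≃ BlockCoord, ∀ x, x ∈ E ↔ ∃ m, x = stdWord m ∘ lam := by
  obtain ⟨p₁, hp₁, hp₁0, hp₁1⟩ := h.exists_cls_eq hk (i := 0) (j := 1) (by decide) (1, 0) 0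
  obtain ⟨p₂, hp₂, hp₂0, hp₂1⟩ := h.exists_cls_eq hk (i := 0) (j := 1) (by decide) (0, 1) 0
  obtain ⟨q₁, hq₁, hq₁0, hq₁2⟩ :=
    h.exists_cls_eq hk (i := 0) (j := 2) (by decide) 0 (cls f 2 p₁)
  obtain ⟨q₂, hq₂, hq₂0, hq₂2⟩ :=
    h.exists_cls_eq hk (i := 0) (j := 2) (by decide) 0 (cls f 2 p₂)
  have hp12 := E.add_mem hp₁ hp₂
  have hq12 := E.add_mem hq₁ hq₂
  have ne_of_add : ∀ a b : ZMod 2 × ZMod 2, a + b ≠ 0 → a ≠ b := by decide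
  have add_of_ne : ∀ a b : ZMod 2 × ZMod 2, a ≠ b → a + b ≠ 0 := by decide
  have hp : ∀ j ≠ 1, cls f j p₁ ≠ 0 ∧ cls f j p₂ ≠ 0 ∧ cls f j p₁ ≠ cls f j p₂ := by
    intro j hj
    refine ⟨h.cls_ne_zero hp₁ hp₁1 (j := 0) ?_ hj.symm, h.cls_ne_zero hp₂ hp₂1 (j := 0) ?_ hj.symm,
      ne_of_add _ _ ?_⟩
    · rw [hp₁0]; decide
    · rw [hp₂0]; decide
    · rw [← map_add]
      refine h.cls_ne_zero hp12 (i := 1) (j := 0) ?_ ?_ hj.symm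
      · rw [map_add, hp₁1, hp₂1, add_zero]
      · rw [map_add, hp₁0, hp₂0]; decide
  obtain ⟨a2, b2, ab2⟩ := hp 2 (by decide)
  have hq : ∀ j ≠ 0, cls f j q₁ ≠ 0 ∧ cls f j q₂ ≠ 0 ∧ cls f j q₁ ≠ cls f j q₂ := by
    intro j hj
    refine ⟨h.cls_ne_zero hq₁ hq₁0 (j := 2) ?_ hj.symm, h.cls_ne_zero hq₂ hq₂0 (j := 2) ?_ hj.symm,
      ne_of_add _ _ ?_⟩
    · rwa [hq₁2]
    · rwa [hq₂2]
    · rw [← map_add]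
      refine h.cls_ne_zero hq12 (i := 0) (j := 2) ?_ ?_ hj.symm
      · rw [map_add, hq₁0, hq₂0, add_zero]
      · rw [map_add, hq₁2, hq₂2]
        exact add_of_ne _ _ ab2
  -- If `q` agreed with `p` on two blocks, `q + p` would have two zero classes and yet a nonzero
  -- class in block 0.
  have mix : ∀ p ∈ E, ∀ q ∈ E, cls f 0 q = 0 → cls f 0 p ≠ 0 → ∀ i j, i ≠ j →
      cls f i q = cls f i p → cls f j q ≠ cls f j p := by
    intro p hp q hq hq0 hp0 i j hij hi
    refine ne_of_add _ _ ?_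
    rw [← map_add]
    refine h.cls_ne_zero (E.add_mem hq hp) (i := i) (j := 0) ?_ ?_ hij
    · rw [map_add, hi, ZModModule.add_self]
    · rwa [map_add, hq0, zero_add]
  have p₁ne : cls f 0 p₁ ≠ 0 := (hp 0 (by decide)).1
  have p₂ne : cls f 0 p₂ ≠ 0 := (hp 0 (by decide)).2.1
  have p₁₂ne : cls f 0 (p₁ + p₂) ≠ 0 := by
    rw [map_add]
    exact add_of_ne _ _ (hp 0 (by decide)).2.2
  have cases_of : ∀ a b c : ZMod 2 × ZMod 2, a ≠ 0 → b ≠ 0 → a ≠ b → c ≠ 0 → c ≠ a →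
      c = b ∨ c = a + b := by
    have key : ∀ a b c : ZMod 2 × ZMod 2,
        a = 0 ∨ b = 0 ∨ a = b ∨ c = 0 ∨ c = a ∨ c = b ∨ c = a + b := by decide
    intro a b c ha hb hab hc hca
    simpa [ha, hb, hab, hc, hca] using key a b c
  /- The classes in two blocks `i` and `j` in which `q₁` has the classes of `p₂` and `p₁ + p₂`. -/
  have main : ∀ i j : Fin 5, i ≠ j → i ≠ 0 → j ≠ 0 → i ≠ 1 → j ≠ 1 → 2 ≠ i → 2 ≠ j →
      cls f i q₁ = cls f i p₂ → cls f j q₁ = cls f j p₁ + cls f j p₂ ∧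
        cls f i q₂ = cls f i p₁ + cls f i p₂ ∧ cls f j q₂ = cls f j p₁ := by
    intro i j hij hi0 hj0 hi1 hj1 hi2 hj2 hi
    have e1 : cls f j q₁ = cls f j p₁ + cls f j p₂ :=
      (cases_of _ _ _ (hp j hj1).1 (hp j hj1).2.1 (hp j hj1).2.2 (hq j hj0).1
        (mix p₁ hp₁ q₁ hq₁ hq₁0 p₁ne 2 j hj2 hq₁2)).resolve_left
        (mix p₂ hp₂ q₁ hq₁ hq₁0 p₂ne i j hij hi)
    have e2 : cls f j q₂ = cls f j p₁ := by
      refine (cases_of _ _ _ (hp j hj1).2.1 (hp j hj1).1 (hp j hj1).2.2.symm (hq j hj0).2.1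
        (mix p₂ hp₂ q₂ hq₂ hq₂0 p₂ne 2 j hj2 hq₂2)).resolve_right fun h' => ?_
      exact (hq j hj0).2.2 (by rw [e1, h', add_comm])
    have e3 : cls f i q₂ = cls f i p₁ + cls f i p₂ := by
      rw [add_comm]
      exact (cases_of _ _ _ (hp i hi1).2.1 (hp i hi1).1 (hp i hi1).2.2.symm (hq i hi0).2.1
        (mix p₂ hp₂ q₂ hq₂ hq₂0 p₂ne 2 i hi2 hq₂2)).resolve_left
        (mix p₁ hp₁ q₂ hq₂ hq₂0 p₁ne j i hij.symm e2)
    exact ⟨e1, e3, e2⟩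
  rcases cases_of _ _ _ (hp 3 (by decide)).1 (hp 3 (by decide)).2.1 (hp 3 (by decide)).2.2
    (hq 3 (by decide)).1 (mix p₁ hp₁ q₁ hq₁ hq₁0 p₁ne 2 3 (by decide) hq₁2) with h3 | h3
  · obtain ⟨e1, e2, e3⟩ := main 3 4 (by decide) (by decide) (by decide) (by decide) (by decide)
      (by decide) (by decide) h3
    exact h.exists_labelling hk hp₁ hp₂ hq₁ hq₂ hp (hq 1 (by decide)) hp₁1 hp₂1 hq₁0 hq₂0 hq₁2 hq₂2
      h3 e2 e1 e3
  -- The other solution has ω and ω² exchanged; renumbering blocks 3 and 4 reduces it to the first.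
  · have h4 : cls f 4 q₁ = cls f 4 p₂ := by
      refine (cases_of _ _ _ (hp 4 (by decide)).1 (hp 4 (by decide)).2.1 (hp 4 (by decide)).2.2
        (hq 4 (by decide)).1 (mix p₁ hp₁ q₁ hq₁ hq₁0 p₁ne 2 4 (by decide) hq₁2)).resolve_right ?_
      rw [← map_add] at h3 ⊢
      exact mix _ hp12 q₁ hq₁ hq₁0 p₁₂ne 3 4 (by decide) h3
    obtain ⟨e1, e2, e3⟩ := main 4 3 (by decide) (by decide) (by decide) (by decide) (by decide)
      (by decide) (by decide) h4
    refine (h.reindex (Equiv.swap 3 4)).exists_labelling hk hp₁ hp₂ hq₁ hq₂ (fun j hj => ?_)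
      (hq 1 (by decide)) hp₁1 hp₂1 hq₁0 hq₂0 hq₁2 hq₂2 h4 e2 e1 e3
    exact hp (Equiv.swap 3 4 j) (by revert j; decide)

end IsTetradFrame

/-! ### The shortened Golay code inside the standard code -/

/-- Labels of the coordinates of the shortened Golay code by those of the standard code. -/
def golayLabel : Fin 20 → BlockCoord :=
  ![(0, 0, 0), (1, 0, 0), (2, 0, 0), (0, 1, 0), (3, 0, 0), (2, 1, 1), (0, 0, 1), (2, 0, 1),
    (0, 1, 1), (4, 0, 1), (1, 1, 1), (3, 1, 0), (3, 1, 1), (1, 1, 0), (4, 1, 0), (3, 0, 1),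
    (4, 0, 0), (4, 1, 1), (2, 1, 0), (1, 0, 1)]

theorem golayLabel_bijective : Function.Bijective golayLabel :=
  (Fintype.bijective_iff_injective_and_card _).2 ⟨by decide, by simp⟩

/-- The words of the standard code in the coordinates of the shortened Golay code. -/
def golayWord : (Fin 9 → ZMod 2) →ₗ[ZMod 2] BinWord 20 :=
  (LinearMap.funLeft (ZMod 2) (ZMod 2) golayLabel).comp stdWord

theorem golayWord_apply (m : Fin 9 → ZMod 2) (i : Fin 20) :
    golayWord m i = stdWord m (golayLabel i) := rfl

theorem golayWord_injective : Function.Injective golayWord :=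
  (LinearMap.funLeft_injective_of_surjective (ZMod 2) (ZMod 2) _
    golayLabel_bijective.surjective).comp stdWord_injective

/-- The functional cutting the shortened Golay code out of the standard code. -/
def golayParity : (Fin 9 → ZMod 2) →ₗ[ZMod 2] ZMod 2 where
  toFun m := m 0 + m 1 + m 2 + m 3 + m 4 + m 7 + m 8
  map_add' m m' := by simp; ring
  map_smul' c m := by simp; ring

/-- The coefficients of the rows of the shortened Golay code. -/
def golayRowCoeff : Fin 8 → Fin 9 → ZMod 2 :=
  ![![1, 0, 1, 1, 0, 1, 0, 0, 1],
    ![0, 1, 0, 0, 0, 1, 1, 1, 0],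
    ![0, 0, 1, 1, 0, 0, 1, 1, 1],
    ![0, 0, 0, 0, 0, 1, 0, 1, 1],
    ![0, 0, 0, 1, 0, 0, 1, 0, 1],
    ![0, 0, 0, 0, 1, 0, 0, 0, 1],
    ![0, 0, 0, 0, 1, 0, 1, 0, 1],
    ![0, 0, 0, 0, 0, 0, 0, 1, 1]]

theorem golayWord_golayRowCoeff : ∀ (i : Fin 8) (j : Fin 20),
    golayWord (golayRowCoeff i) j = golayRow (Fin.natAdd 4 i) (Fin.natAdd 4 j) := by
  decide +kernel

theorem golayRow_natAdd_castAdd : ∀ (i : Fin 8) (j : Fin 4),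
    golayRow (Fin.natAdd 4 i) (Fin.castAdd 20 j) = 0 := by
  decide +kernel

theorem golayWord_golayRowCoeff_mem (i : Fin 8) :
    golayWord (golayRowCoeff i) ∈ shortenedGolay :=
  ⟨golayRow (Fin.natAdd 4 i), Submodule.subset_span ⟨_, rfl⟩, golayRow_natAdd_castAdd i,
    fun j => (golayWord_golayRowCoeff i j).symm⟩

/-- A basis of the kernel of `golayParity`. -/
def golayKer (k : Fin 8) : Fin 9 → ZMod 2 :=
  Pi.single k.succ 1 + golayParity (Pi.single k.succ 1) • Pi.single 0 1

/-- The eight rows span the whole kernel of `golayParity`, not merely a part of it. -/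
theorem golayKer_eq : ∀ k, golayKer k =
    ∑ i, (![![1, 1, 1, 0, 0, 0, 0, 0],
      ![1, 0, 0, 1, 1, 1, 1, 1],
      ![1, 0, 1, 1, 1, 0, 0, 0],
      ![1, 0, 1, 1, 0, 0, 1, 0],
      ![0, 0, 0, 1, 0, 0, 0, 1],
      ![0, 0, 0, 0, 0, 1, 1, 0],
      ![1, 0, 1, 1, 0, 1, 1, 1],
      ![1, 0, 1, 1, 0, 1, 1, 0]] k i : ZMod 2) • golayRowCoeff i := by
  decide +kernel

theorem eq_sum_golayKer {m : Fin 9 → ZMod 2} (hm : golayParity m = 0) :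
    m = ∑ k : Fin 8, m k.succ • golayKer k := by
  have h : ∑ k : Fin 8, m k.succ • golayKer k = m + golayParity m • Pi.single 0 1 := by
    have two : (2 : ZMod 2) = 0 := rfl
    funext i
    fin_cases i <;> simp [golayKer, golayParity, Fin.sum_univ_succ, Pi.single_apply]
    linear_combination -m 0 * two
  rw [h, hm, zero_smul, add_zero]

theorem mem_shortenedGolay_iff {x : BinWord 20} :
    x ∈ shortenedGolay ↔ ∃ m, golayParity m = 0 ∧ x = golayWord m := by
  constructor
  · rintro ⟨w, hw, hw0, hwx⟩
    obtain ⟨c, rfl⟩ := (Submodule.mem_span_range_iff_exists_fun (ZMod 2)).1 hw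
    -- The leading 4 × 4 corner of the generator matrix is unitriangular and the later rows vanish
    -- there, so starting with 0000 kills the first four coefficients.
    have hfirst : ∀ i : Fin 4, c (Fin.castAdd 8 i) = 0 := by
      have hrow : ∀ (i : Fin 4) (j : Fin 4), golayRow (Fin.castAdd 8 i) (Fin.castAdd 20 j) =
          ![![1, 0, 1, 0], ![0, 1, 0, 1], ![0, 0, 1, 0], ![0, 0, 0, 1]] i j := by
        decide +kernel
      have hw0' : ∀ j : Fin 4, ∑ i : Fin 4, c (Fin.castAdd 8 i) *
          golayRow (Fin.castAdd 8 i) (Fin.castAdd 20 j) = 0 := by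
        intro j
        have h := hw0 j
        rw [Finset.sum_apply] at h
        have h' := (Fin.sum_univ_add (a := 4) (b := 8) fun i =>
          (c i • golayRow i) (Fin.castAdd 20 j)).symm.trans h
        simpa [golayRow_natAdd_castAdd] using h'
      simp only [hrow] at hw0'
      have h0 := hw0' 0
      have h1 := hw0' 1
      have h2 := hw0' 2
      have h3 := hw0' 3
      simp [Fin.sum_univ_four] at h0 h1 h2 h3
      intro i
      fin_cases i
      · exact h0
      · exact h1
      · simpa [h0] using h2
      · simpa [h1] using h3
    refine ⟨∑ i : Fin 8, c (Fin.natAdd 4 i) • golayRowCoeff i, ?_, ?_⟩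
    · have h : ∀ i, golayParity (golayRowCoeff i) = 0 := by decide +kernel
      simp [h]
    · funext j
      rw [← hwx j, map_sum, Finset.sum_apply, Finset.sum_apply]
      refine (Fin.sum_univ_add (a := 4) (b := 8) fun i =>
          (c i • golayRow i) (Fin.natAdd 4 j)).trans ?_
      simp [hfirst, golayWord_golayRowCoeff]
  · rintro ⟨m, hm, rfl⟩
    rw [eq_sum_golayKer hm, map_sum]
    refine Submodule.sum_mem _ fun k _ => ?_
    rw [map_smul, golayKer_eq, map_sum]
    refine Submodule.smul_mem _ _ (Submodule.sum_mem _ fun i _ => ?_)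
    rw [map_smul]
    exact Submodule.smul_mem _ _ (golayWord_golayRowCoeff_mem i)

/-! ### Words of weight 16, their span and its cosets -/

/-- The coefficients of the word constant on blocks with values `c`. -/
def blockCoeff (c : Fin 5 → ZMod 2) : Fin 9 → ZMod 2 := ![c 0, c 1, c 2, c 3, c 4, 0, 0, 0, 0]

/-- The coefficients of the words of weight 16: ones on all blocks but the `j`-th. -/
def weightSixteenCoeff (j : Fin 5) : Fin 9 → ZMod 2 := blockCoeff fun k => if k = j then 0 else 1

theorem weightSixteenCoeff_injective : Function.Injective weightSixteenCoeff := by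
  decide +kernel

/-- The weight of an affine function `c + a * s + b * t` on `𝔽₂²`. -/
theorem sum_val_affine : ∀ a b c : ZMod 2, ∑ p : ZMod 2 × ZMod 2, (c + a * p.1 + b * p.2).val =
    if a = 0 ∧ b = 0 then 4 * c.val else 2 := by
  decide

theorem hammingNorm_golayWord (m : Fin 9 → ZMod 2) : hammingNorm (golayWord m) =
    (if m 5 = 0 ∧ m 6 = 0 then 4 * (m 0).val else 2) +
    (if m 7 = 0 ∧ m 8 = 0 then 4 * (m 1).val else 2) +
    (if m 5 + m 7 = 0 ∧ m 6 + m 8 = 0 then 4 * (m 2).val else 2) +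
    (if m 5 + m 8 = 0 ∧ m 6 + m 7 + m 8 = 0 then 4 * (m 3).val else 2) +
    (if m 5 + m 7 + m 8 = 0 ∧ m 6 + m 7 = 0 then 4 * (m 4).val else 2) := by
  simp only [← sum_val_affine]
  rw [hammingNorm_eq_sum_val]
  simp only [golayWord_apply]
  rw [golayLabel_bijective.sum_comp fun p => (stdWord m p).val, Fintype.sum_prod_type,
    Fin.sum_univ_five]
  rfl

theorem mem_weightSixteenWords_iff {x : BinWord 20} :
    x ∈ weightSixteenWords ↔ ∃ j, golayWord (weightSixteenCoeff j) = x := by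
  have h1 : ∀ m : Fin 9 → ZMod 2, golayParity m = 0 ∧ hammingNorm (golayWord m) = 16 →
      ∃ j, weightSixteenCoeff j = m := by
    simp only [hammingNorm_golayWord]
    decide +kernel
  have h2 : ∀ j, golayParity (weightSixteenCoeff j) = 0 ∧
      hammingNorm (golayWord (weightSixteenCoeff j)) = 16 := by
    decide +kernel
  constructor
  · rintro ⟨hx, hw⟩
    obtain ⟨m, hm, rfl⟩ := mem_shortenedGolay_iff.1 hx
    obtain ⟨j, rfl⟩ := h1 m ⟨hm, hw⟩
    exact ⟨j, rfl⟩
  · rintro ⟨j, rfl⟩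
    exact ⟨mem_shortenedGolay_iff.2 ⟨_, (h2 j).1, rfl⟩, (h2 j).2⟩

theorem ncard_weightSixteenWords : weightSixteenWords.ncard = 5 := by
  have h : weightSixteenWords = (golayWord ∘ weightSixteenCoeff) '' Set.univ := by
    ext x
    simp [mem_weightSixteenWords_iff]
  rw [h, Set.ncard_image_of_injective _ (golayWord_injective.comp weightSixteenCoeff_injective),
    Set.ncard_univ, Nat.card_eq_fintype_card, Fintype.card_fin]

theorem mem_spanD_iff {x : BinWord 20} :
    x ∈ spanD ↔ ∃ c : Fin 5 → ZMod 2, ∑ j, c j = 0 ∧ x = golayWord (blockCoeff c) := by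
  constructor
  · intro hx
    induction hx using Submodule.span_induction with
    | mem x hx =>
      obtain ⟨j, rfl⟩ := mem_weightSixteenWords_iff.1 hx
      exact ⟨_, by clear hx; revert j; decide, rfl⟩
    | zero => exact ⟨0, by simp, by rw [← map_zero golayWord]; congr 1; decide⟩
    | add x y _ _ hx hy =>
      obtain ⟨c, hc, rfl⟩ := hx
      obtain ⟨d, hd, rfl⟩ := hy
      refine ⟨c + d, by simp [Finset.sum_add_distrib, hc, hd], ?_⟩
      rw [← map_add]
      congr 1
      funext i
      fin_cases i <;> simp [blockCoeff]
    | smul a x _ hx =>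
      obtain ⟨c, hc, rfl⟩ := hx
      refine ⟨a • c, by simp [← Finset.mul_sum, hc], ?_⟩
      rw [← map_smul]
      congr 1
      funext i
      fin_cases i <;> simp [blockCoeff]
  · rintro ⟨c, hc, rfl⟩
    -- A word of `D` is 𝟏 plus a block; when the sum of `c` is zero the copies of 𝟏 cancel.
    have h : ∀ c : Fin 5 → ZMod 2, ∑ j, c j = 0 →
        blockCoeff c = ∑ j, c j • weightSixteenCoeff j := by
      decide +kernel
    rw [h c hc, map_sum]
    refine Submodule.sum_mem _ fun j _ => ?_
    rw [map_smul]
    exact Submodule.smul_mem _ _ (Submodule.subset_span (mem_weightSixteenWords_iff.2 ⟨j, rfl⟩))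

theorem blockCoeff_eq_sum (c : Fin 5 → ZMod 2) :
    blockCoeff c = ∑ j, c j • blockCoeff (Pi.single j 1) := by
  funext i
  fin_cases i <;> simp [blockCoeff, Fin.sum_univ_five]

theorem golayWord_blockCoeff_one : golayWord (blockCoeff 1) = 1 := by
  decide +kernel

/-- The coefficients of a representative of the coset with given classes. -/
def cosetCoeff (b : Fin 4 → ZMod 2) : Fin 9 → ZMod 2 :=
  -- The first entry makes `golayParity` vanish.
  ![b 2 + b 3, 0, 0, 0, 0, b 0, b 1, b 2, b 3]

/-- Elements of `⟨D⟩` have zero in the last four coefficients, and these four bits determine the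
coset within `B`. -/
theorem exists_isCosetReps : ∃ u : Fin 16 → BinWord 20, IsCosetReps u := by
  have e : Fin 16 ≃ (Fin 4 → ZMod 2) := (Fintype.equivFinOfCardEq (by simp)).symm
  refine ⟨fun i => golayWord (cosetCoeff (e i)), fun i => ?_, fun x hx => ?_⟩
  · refine mem_shortenedGolay_iff.2 ⟨_, ?_, rfl⟩
    generalize e i = b
    have two : (2 : ZMod 2) = 0 := rfl
    simp [golayParity, cosetCoeff]
    linear_combination (b 2 + b 3) * two
  · obtain ⟨m, hm, rfl⟩ := mem_shortenedGolay_iff.1 hx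
    refine ⟨e.symm ![m 5, m 6, m 7, m 8], ?_, fun i hi => ?_⟩
    · beta_reduce
      rw [Equiv.apply_symm_apply, mem_spanD_iff]
      refine ⟨![m 0 - m 7 - m 8, m 1, m 2, m 3, m 4], ?_, ?_⟩
      · have two : (2 : ZMod 2) = 0 := rfl
        simp [golayParity, Fin.sum_univ_five] at hm ⊢
        linear_combination hm - (m 7 + m 8) * two
      · rw [← map_sub]
        congr 1
        funext i
        fin_cases i <;> simp [blockCoeff, cosetCoeff]
        ring
    · obtain ⟨c, -, hc⟩ := mem_spanD_iff.1 hi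
      rw [← map_sub] at hc
      have hc' := congrFun (golayWord_injective hc)
      rw [Equiv.eq_symm_apply]
      have h5 := hc' 5
      have h6 := hc' 6
      have h7 := hc' 7
      have h8 := hc' 8
      simp [blockCoeff, cosetCoeff, sub_eq_zero] at h5 h6 h7 h8
      funext k
      fin_cases k
      exacts [h5.symm, h6.symm, h7.symm, h8.symm]

/-! ### Halves of the standard code and replaced cosets -/

/-- A set split by each of the five blocks is split by a combination of blocks exactly if the
combination is odd. -/
theorem add_blockCoeff_mem_iff {A : Set (Fin 9 → ZMod 2)}
    (hA : ∀ m j, m ∈ A ↔ m + blockCoeff (Pi.single j 1) ∉ A) (m : Fin 9 → ZMod 2)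
    (c : Fin 5 → ZMod 2) : m + blockCoeff c ∈ A ↔ (m ∈ A ↔ ∑ j, c j = 0) := by
  have step : ∀ (s : ZMod 2) m j, m + s • blockCoeff (Pi.single j 1) ∈ A ↔ (m ∈ A ↔ s = 0) := by
    intro s m j
    obtain rfl | rfl : s = 0 ∨ s = 1 := by revert s; decide
    · simp
    · have := hA m j
      simp only [one_smul, one_ne_zero, iff_false]
      tauto
  have h2 : ∀ a b : ZMod 2, ((a = 0 ↔ b = 0) ↔ a + b = 0) := by decide
  rw [blockCoeff_eq_sum]
  simp only [Fin.sum_univ_five, ← add_assoc, step, ← h2]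
  tauto

/-- The all-ones word is the sum of five blocks, an odd number of flips. -/
theorem one_add_mem_iff {A : Set (Fin 9 → ZMod 2)}
    (hA : ∀ m j, m ∈ A ↔ m + blockCoeff (Pi.single j 1) ∉ A) (m : Fin 9 → ZMod 2) :
    blockCoeff 1 + m ∈ A ↔ m ∉ A := by
  have h : ∑ _j : Fin 5, (1 : Fin 5 → ZMod 2) _j ≠ 0 := by decide
  rw [add_comm, add_blockCoeff_mem_iff hA]
  simp only [h, iff_false]

/-- A half of the standard code split by the five blocks arises from the shortened Golay code by
replacing cosets. -/
theorem golayWord_image_eq_replaceCosets {A : Set (Fin 9 → ZMod 2)}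
    (hA : ∀ m j, m ∈ A ↔ m + blockCoeff (Pi.single j 1) ∉ A) {u : Fin 16 → BinWord 20}
    (hu : IsCosetReps u) :
    golayWord '' A = replaceCosets u {i | 1 + u i ∈ golayWord '' A} := by
  have hmem : ∀ m, golayWord m ∈ golayWord '' A ↔ m ∈ A := fun m =>
    golayWord_injective.mem_set_image
  have hone : ∀ x ∈ shortenedGolay, (1 + x ∈ golayWord '' A ↔ x ∉ golayWord '' A) := by
    intro x hx
    obtain ⟨m, -, rfl⟩ := mem_shortenedGolay_iff.1 hx
    rw [← golayWord_blockCoeff_one, ← map_add, hmem, hmem, one_add_mem_iff hA]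
  have hspan : ∀ m, ∀ y ∈ spanD, (golayWord m + y ∈ golayWord '' A ↔
      golayWord m ∈ golayWord '' A) := by
    intro m y hy
    obtain ⟨c, hc, rfl⟩ := mem_spanD_iff.1 hy
    rw [← map_add, hmem, hmem, add_blockCoeff_mem_iff hA]
    simp [hc]
  have hspan' : ∀ x ∈ shortenedGolay, ∀ y ∈ spanD, (x + y ∈ golayWord '' A ↔
      x ∈ golayWord '' A) := by
    intro x hx
    obtain ⟨m, -, rfl⟩ := mem_shortenedGolay_iff.1 hx
    exact hspan m
  have hspan1 : ∀ x ∈ shortenedGolay, ∀ y ∈ spanD, (1 + x + y ∈ golayWord '' A ↔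
      1 + x ∈ golayWord '' A) := by
    intro x hx
    obtain ⟨m, -, rfl⟩ := mem_shortenedGolay_iff.1 hx
    rw [← golayWord_blockCoeff_one, ← map_add]
    exact hspan _
  -- `golayParity` is 1 on the all-ones word, so the standard code is `B ∪ (𝟏 + B)`.
  have hsplit : ∀ m, golayWord m ∈ shortenedGolay ∨ ∃ x ∈ shortenedGolay, golayWord m = 1 + x := by
    intro m
    by_cases hm : golayParity m = 0
    · exact Or.inl (mem_shortenedGolay_iff.2 ⟨m, hm, rfl⟩)
    · refine Or.inr ⟨golayWord (blockCoeff 1 + m), mem_shortenedGolay_iff.2 ⟨_, ?_, rfl⟩, ?_⟩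
      · have h1 : golayParity (blockCoeff 1) = 1 := by decide
        have h2 : ∀ a : ZMod 2, a ≠ 0 → 1 + a = 0 := by decide
        rw [map_add, h1]
        exact h2 _ hm
      · rw [map_add, golayWord_blockCoeff_one, ← add_assoc, ZModModule.add_self, zero_add]
  ext x
  simp only [replaceCosets, cosetD, Set.mem_union, Set.mem_sdiff, Set.mem_iUnion, Set.mem_ofPred_eq,
    SetLike.mem_coe, exists_prop, not_exists, not_and]
  constructor
  · rintro ⟨m, hm, rfl⟩
    have hm' := (hmem m).2 hm
    rcases hsplit m with hx | ⟨x, hx, hmx⟩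
    · refine Or.inl ⟨hx, fun i hi y hy hxy => ?_⟩
      rw [hxy, hspan' _ (hu.1 i) y hy] at hm'
      exact (hone _ (hu.1 i)).1 hi hm'
    · obtain ⟨i, hi, -⟩ := hu.2 x hx
      have hxi : golayWord m = 1 + u i + (x - u i) := by rw [hmx]; abel
      rw [hxi, hspan1 _ (hu.1 i) _ hi] at hm'
      exact Or.inr ⟨i, hm', x - u i, hi, hxi⟩
  · rintro (⟨hx, hnot⟩ | ⟨i, hi, y, hy, rfl⟩)
    · obtain ⟨i, hi, -⟩ := hu.2 x hx
      have hxi : x = u i + (x - u i) := by abel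
      have hn : 1 + u i ∉ golayWord '' A := fun h => hnot i h _ hi hxi
      rw [hxi, hspan' _ (hu.1 i) _ hi]
      by_contra h
      exact hn ((hone _ (hu.1 i)).2 h)
    · exact (hspan1 _ (hu.1 i) y hy).2 hi

theorem hammingNorm_comp_blockCoeff (lam : Fin 20 ≃ BlockCoord) (j : Fin 5) :
    hammingNorm (stdWord (blockCoeff (Pi.single j 1)) ∘ lam : BinWord 20) = 4 := by
  rw [hammingNorm_eq_sum_val]
  simp only [Function.comp_apply]
  rw [Equiv.sum_comp lam fun p => (stdWord (blockCoeff (Pi.single j 1)) p).val]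
  revert j
  decide +kernel

/-- A code containing zero is, up to the order of coordinates, a half of the standard code. -/
theorem exists_stdWord_of_code {C : Set (BinWord 20)} (hC : IsBinaryCode 20 8 C)
    (h0 : (0 : BinWord 20) ∈ C) (hcard : C.ncard = 256)
    (h4 : ∀ x ∈ C, ∀ y ∈ C, 4 ∣ hammingDist x y) :
    ∃ (lam : Fin 20 ≃ BlockCoord) (A : Set (Fin 9 → ZMod 2)),
      (∀ m j, m ∈ A ↔ m + blockCoeff (Pi.single j 1) ∉ A) ∧
      C = (fun m => stdWord m ∘ lam) '' A := by
  obtain ⟨E, hE, h1, hk, hCE, hsplit⟩ := exists_doublyEven_of_code hC h0 hcard h4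
  have hadd : ∀ t ∈ E, ∀ t' ∈ E, hammingNorm t = 4 → hammingNorm t' = 4 →
      hammingNorm (t + t') ≠ 4 := by
    intro t ht t' ht' ht4 ht4' h
    -- Passing from 0 to `t + t'` through `t` flips membership twice; if `t + t'` were a tetrad, it
    -- would flip only once.
    have e1 := hsplit t ht ht4 0 E.zero_mem
    have e2 := hsplit t' ht' ht4' t ht
    have e3 := hsplit (t + t') (E.add_mem ht ht') h 0 E.zero_mem
    rw [zero_add] at e1 e3
    tauto
  obtain ⟨f, hf⟩ := exists_isTetradFrame hE h1 hk hadd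
  obtain ⟨lam, hlam⟩ := hf.exists_labelling_of_frame hk
  refine ⟨lam, {m | stdWord m ∘ lam ∈ C}, fun m j => ?_, ?_⟩
  · have h := hsplit _ ((hlam _).2 ⟨_, rfl⟩) (hammingNorm_comp_blockCoeff lam j) _
      ((hlam _).2 ⟨m, rfl⟩)
    simp only [Set.mem_ofPred_eq, map_add]
    exact h
  · ext x
    constructor
    · intro hx
      obtain ⟨m, rfl⟩ := (hlam x).1 (hCE hx)
      exact ⟨m, hx, rfl⟩
    · rintro ⟨m, hm, rfl⟩
      exact hm

theorem mainTheorem5 :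
    weightSixteenWords.ncard = 5 ∧
    (∃ u : Fin 16 → BinWord 20, IsCosetReps u) ∧
    ∀ u : Fin 16 → BinWord 20, IsCosetReps u →
      ∀ C : Set (BinWord 20), IsBinaryCode 20 8 C → C.ncard = 256 →
        (∀ x ∈ C, ∀ y ∈ C, 4 ∣ hammingDist x y) →
        ∃ S : Set (Fin 16), CodeEquivalent C (replaceCosets u S) := by
  refine ⟨ncard_weightSixteenWords, exists_isCosetReps, fun u hu C hC hcard h4 => ?_⟩
  obtain ⟨c₀, hc₀⟩ : C.Nonempty := Set.nonempty_of_ncard_ne_zero (by omega)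
  have hdist : ∀ x y : BinWord 20, hammingDist (x + c₀) (y + c₀) = hammingDist x y := by
    intro x y
    rw [hammingDist_eq_hammingNorm_add, hammingDist_eq_hammingNorm_add, add_add_add_comm,
      ZModModule.add_self, add_zero]
  obtain ⟨lam, A, hA, hCA⟩ := exists_stdWord_of_code (C := (· + c₀) '' C)
    (by
      rintro _ ⟨x, hx, rfl⟩ _ ⟨y, hy, rfl⟩ hne
      rw [hdist]
      exact hC x hx y hy fun h => hne (by rw [h]))
    ⟨c₀, hc₀, ZModModule.add_self c₀⟩
    (by rw [Set.ncard_image_of_injective _ (add_left_injective c₀), hcard])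
    (by
      rintro _ ⟨x, hx, rfl⟩ _ ⟨y, hy, rfl⟩
      rw [hdist]
      exact h4 x hx y hy)
  let lab := Equiv.ofBijective golayLabel golayLabel_bijective
  -- The translation by `c₀` that put 0 into the code becomes a permutation of the alphabet in each
  -- coordinate.
  refine ⟨{i | 1 + u i ∈ golayWord '' A}, lab.trans lam.symm, fun i => Equiv.addRight (c₀ (lam.symm (lab i))), ?_⟩
  rw [← golayWord_image_eq_replaceCosets hA hu]
  have hmap : (fun (x : BinWord 20) (i : Fin 20) =>
      Equiv.addRight (c₀ (lam.symm (lab i))) (x ((lab.trans lam.symm) i))) '' C =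
      (fun (x : BinWord 20) i => x (lam.symm (lab i))) '' ((· + c₀) '' C) := by
    rw [Set.image_image]
    rfl
  rw [hmap, hCA, Set.image_image]
  refine Set.image_congr fun m _ => ?_
  funext i
  simp [golayWord_apply, lab]
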